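/- Let $b\ge 2$ be a fixed integer and let $U$ be a random variable uniformly distributed on $[0,1]$, with base-$b$ expansion $U=\sum_{t\ge 1}D_t b^{-t}$, $D_t\in\{0,\dots,b-1\}$ (almost surely unique). For $m\ge 1$ let $U_m=\sum_{t=1}^m D_t b^{-t}$ be its $m$-digit truncation, and for $1\le j\le b-1$ put $$\bar Z_j=\bar Z_j^{(m)}=\frac1m\sum_{t=1}^m e^{2\pi i\, j b^{t-1}U_m}.$$ Then, as $m\to\infty$, $$\bigl(\sqrt m\,\bar Z_1,\dots,\sqrt m\,\bar Z_{b-1}\bigr)\xrightarrow{d}\mathcal{CN}_{b-1}(0,I_{b-1}),$$ where $\mathcal{CN}_{b-1}(0,I_{b-1})$ is the law of a vector of $b-1$ independent complex random variables $X_j+iY_j$ with $X_j,Y_j$ independent and each $\mathcal N(0,1/2)$. Moreover $$T=T^{(m)}=2m\sum_{j=1}^{b-1}|\bar Z_j|^2\xrightarrow{d}\chi^2_{2(b-1)},$$ the chi-square law with $2(b-1)$ degrees of freedom. -/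

import Mathlib

open MeasureTheory ProbabilityTheory Filter
open scoped Topology

noncomputable section

namespace Lacunary

/-- The digit `D_t` (for `t ≥ 1`) of the base-`b` expansion `u = ∑_{t ≥ 1} D_t / b ^ t`
of `u ∈ [0, 1)`. Mathlib's digit sequence `Real.digits` starts at index `0`. -/
def digit (b : ℕ) [NeZero b] (u : ℝ) (t : ℕ) : ℕ := (Real.digits u b (t - 1) : ℕ)

/-- The `m`-digit base-`b` truncation `u_m = ∑_{t=1}^m D_t / b ^ t`. -/
def digitTrunc (b : ℕ) [NeZero b] (m : ℕ) (u : ℝ) : ℝ :=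
  ∑ t ∈ Finset.Icc 1 m, (digit b u t : ℝ) / (b : ℝ) ^ t

/-- The lacunary frequency `k_{j,t} = j * b ^ (t - 1)` (for `t ≥ 1`). -/
def freq (b j t : ℕ) : ℕ := j * b ^ (t - 1)

/-- The harmonic component `Z_{j,t} = exp (2 π i k_{j,t} u_m)`. -/
def harmonicComponent (b : ℕ) [NeZero b] (m j t : ℕ) (u : ℝ) : ℂ :=
  Complex.exp (2 * Real.pi * Complex.I * (freq b j t : ℂ) * (digitTrunc b m u : ℂ))

/-- The average `(1 / m) * ∑_{t=1}^m Z_{j,t}`. -/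
def harmonicAverage (b : ℕ) [NeZero b] (m j : ℕ) (u : ℝ) : ℂ :=
  (1 / (m : ℂ)) * ∑ t ∈ Finset.Icc 1 m, harmonicComponent b m j t u

/-- The vector of the normalized averages of orders `1, …, b - 1`; the coordinate with index
`i : Fin (b - 1)` belongs to the order `j = i + 1`. -/
def scaledVector (b : ℕ) [NeZero b] (m : ℕ) (u : ℝ) : Fin (b - 1) → ℂ :=
  fun i => ((√(m : ℝ) : ℝ) : ℂ) * harmonicAverage b m (i + 1) u

/-- The test statistic `T = 2 m ∑_{j=1}^{b-1} |Z̄_j|²`. -/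
def testStatistic (b : ℕ) [NeZero b] (m : ℕ) (u : ℝ) : ℝ :=
  2 * (m : ℝ) * ∑ j ∈ Finset.Icc 1 (b - 1), ‖harmonicAverage b m j u‖ ^ 2

/-- The standard complex normal law `CN(0, 1)`: the law of `X + i Y` with `X`, `Y` independent,
both `N(0, 1/2)`. -/
def complexNormal : Measure ℂ :=
  ((gaussianReal 0 (1 / 2)).prod (gaussianReal 0 (1 / 2))).map
    (fun p : ℝ × ℝ => (p.1 : ℂ) + (p.2 : ℂ) * Complex.I)

instance isProbabilityMeasure_complexNormal : IsProbabilityMeasure complexNormal :=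
  Measure.isProbabilityMeasure_map (by fun_prop)

/-- The standard `n`-variate complex normal law `CN_n(0, I_n)`: the law of a vector of `n`
independent `CN(0, 1)` variables. -/
def stdComplexNormal (n : ℕ) : Measure (Fin n → ℂ) := Measure.pi fun _ => complexNormal

instance isProbabilityMeasure_stdComplexNormal (n : ℕ) : IsProbabilityMeasure (stdComplexNormal n) := by
  unfold stdComplexNormal; infer_instance

/-- The chi-square law with `k` degrees of freedom: the law of the sum of the squares of `k`
independent `N(0, 1)` variables. -/
def chiSquare (k : ℕ) : Measure ℝ :=
  (Measure.pi fun _ : Fin k => gaussianReal 0 1).map (fun x => ∑ i, x i ^ 2)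

instance isProbabilityMeasure_chiSquare (k : ℕ) : IsProbabilityMeasure (chiSquare k) :=
  Measure.isProbabilityMeasure_map
    (Measurable.aemeasurable (Finset.measurable_sum _ fun i _ => by fun_prop))

end Lacunary

end

noncomputable section

namespace Lacunary

/-! Since `|U_m - U| ≤ b ^ (-m)`, replacing `U_m` by `U` changes each sum of harmonics by an amount
bounded uniformly in `m` (a geometric series), which the factor `1 / √m` kills
(`norm_sqrt_mul_harmonicAverage_sub_le`). Pairing the vector with a fixed `w` then leaves the
lacunary sum `(1 / √m) ∑ f (b ^ k U)`, where `f` is a real trigonometric polynomial whose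
frequencies `± j`, `1 ≤ j ≤ b - 1`, are not divisible by `b`.

For such sums the central limit theorem follows the method of Salem-Zygmund and McLeish. With `y_k =
f (b ^ k x) / √m`, the exponential `exp (i ∑ y_k)` is close to `exp (-∑ y_k² / 2) ∏ (1 + i y_k)`.
The product has mean exactly `1` (`integral_prod_one_add`), and `∑ y_k²` tends in `L¹` to the mean
`v` of `f²` (`integral_norm_average_sub_le`), so the characteristic function tends to `exp (-v /
2)`. Here `v = ∑ |w_i|² / 2`, which is the complex normal case. Lévy's theorem gives the vector
limit, and continuous mapping with `map_two_mul_sum_normSq_stdComplexNormal` gives the chi-square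
limit. -/

/-! ### Comparison of exponentials with products -/

theorem norm_one_add_mul_I_sq (x : ℝ) : ‖(1 : ℂ) + x * Complex.I‖ ^ 2 = 1 + x ^ 2 := by
  rw [← Complex.normSq_eq_norm_sq]
  simp [Complex.normSq_apply]
  ring

theorem norm_one_add_mul_I_le (x : ℝ) : ‖(1 : ℂ) + x * Complex.I‖ ≤ Real.exp (x ^ 2 / 2) := by
  refine le_of_sq_le_sq ?_ (Real.exp_nonneg _)
  have h : ((2 : ℕ) : ℝ) * (x ^ 2 / 2) = x ^ 2 := by push_cast; ring
  rw [norm_one_add_mul_I_sq, ← Real.exp_nat_mul, h, add_comm]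
  exact Real.add_one_le_exp (x ^ 2)

/-- The second-order comparison behind `exp (i x) = (1 + i x) exp (-x² / 2 + O (x³))`. -/
theorem norm_exp_mul_I_sub_le {x : ℝ} (hx : |x| ≤ 1) :
    ‖Complex.exp (x * Complex.I) - (1 + x * Complex.I) * Complex.exp ((-(x ^ 2 / 2) : ℝ))‖
      ≤ 4 * |x| ^ 3 := by
  have h1 : ‖Complex.exp (x * Complex.I) - (1 + x * Complex.I - x ^ 2 / 2)‖ ≤ |x| ^ 3 := by
    have h := Complex.exp_bound (x := x * Complex.I) (by simpa using hx) (n := 3) (by norm_num)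
    simp [Finset.sum_range_succ, Nat.factorial, mul_pow] at h
    have h0 : 0 ≤ |x| ^ 3 := by positivity
    refine le_trans (le_of_eq ?_) (h.trans (by nlinarith))
    congr 1
    ring
  have h2 : ‖Complex.exp ((-(x ^ 2 / 2) : ℝ)) - (1 - x ^ 2 / 2)‖ ≤ |x| ^ 3 := by
    have hx2 : x ^ 2 ≤ 1 := by rw [← sq_abs]; exact pow_le_one₀ (abs_nonneg _) hx
    have h := Complex.exp_bound (x := ((-(x ^ 2 / 2) : ℝ) : ℂ))
      (by rw [Complex.norm_real, Real.norm_eq_abs, abs_neg, abs_of_nonneg (by positivity)]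
          linarith) (n := 2) (by norm_num)
    have h4 : x ^ 4 ≤ |x| ^ 3 := by
      have : x ^ 4 = |x| ^ 4 := by rw [pow_abs, abs_of_nonneg (by positivity)]
      rw [this]
      exact pow_le_pow_of_le_one (abs_nonneg _) hx (by norm_num)
    rw [Complex.norm_real, Real.norm_eq_abs, abs_neg, abs_of_nonneg (by positivity)] at h
    simp [Finset.sum_range_succ, Nat.factorial] at h
    refine le_trans (le_of_eq ?_) (h.trans ?_)
    · congr 1
      push_cast
      ring
    · have h0 : 0 ≤ |x| ^ 3 := by positivity
      have : (x ^ 2 / 2) ^ 2 = x ^ 4 / 4 := by ring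
      rw [this]
      nlinarith
  have h3 : ‖(1 : ℂ) + x * Complex.I‖ ≤ 2 := by
    refine (norm_add_le _ _).trans ?_
    simp
    linarith
  have h5 : ‖(x : ℂ) ^ 3 * Complex.I / 2‖ ≤ |x| ^ 3 := by
    have h0 : 0 ≤ |x| ^ 3 := by positivity
    simp
  -- Since `(1 + i x) (1 - x² / 2) = 1 + i x - x² / 2 - i x³ / 2`, only third-order terms remain;
  -- the three bounds `1`, `2`, `1` add up to the constant `4`.
  have key : Complex.exp (x * Complex.I) - (1 + x * Complex.I) * Complex.exp ((-(x ^ 2 / 2) : ℝ))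
      = (Complex.exp (x * Complex.I) - (1 + x * Complex.I - x ^ 2 / 2))
        - (1 + x * Complex.I) * (Complex.exp ((-(x ^ 2 / 2) : ℝ)) - (1 - x ^ 2 / 2))
        + (x : ℂ) ^ 3 * Complex.I / 2 := by
    ring
  rw [key]
  have h6 : ‖(1 + x * Complex.I) * (Complex.exp ((-(x ^ 2 / 2) : ℝ)) - (1 - x ^ 2 / 2))‖
      ≤ 2 * |x| ^ 3 := by
    rw [norm_mul]
    gcongr
  linarith [norm_add_le ((Complex.exp (x * Complex.I) - (1 + x * Complex.I - x ^ 2 / 2))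
        - (1 + x * Complex.I) * (Complex.exp ((-(x ^ 2 / 2) : ℝ)) - (1 - x ^ 2 / 2)))
        ((x : ℂ) ^ 3 * Complex.I / 2),
        norm_sub_le (Complex.exp (x * Complex.I) - (1 + x * Complex.I - x ^ 2 / 2))
        ((1 + x * Complex.I) * (Complex.exp ((-(x ^ 2 / 2) : ℝ)) - (1 - x ^ 2 / 2)))]

theorem norm_prod_sub_prod_le {ι : Type*} (s : Finset ι) (u v : ι → ℂ)
    (hu : ∀ i ∈ s, ‖u i‖ ≤ 1) (hv : ∀ i ∈ s, ‖v i‖ ≤ 1) :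
    ‖∏ i ∈ s, u i - ∏ i ∈ s, v i‖ ≤ ∑ i ∈ s, ‖u i - v i‖ := by
  classical
  induction s using Finset.induction_on with
  | empty => simp
  | insert a s ha ih =>
    rw [Finset.prod_insert ha, Finset.prod_insert ha, Finset.sum_insert ha]
    have h1 := ih (fun i hi => hu i (Finset.mem_insert_of_mem hi))
      (fun i hi => hv i (Finset.mem_insert_of_mem hi))
    have h2 : ‖∏ i ∈ s, v i‖ ≤ 1 := by
      rw [norm_prod]
      exact Finset.prod_le_one (fun i _ => norm_nonneg _)
        (fun i hi => hv i (Finset.mem_insert_of_mem hi))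
    have h3 := hu a (Finset.mem_insert_self _ _)
    have : u a * ∏ i ∈ s, u i - v a * ∏ i ∈ s, v i
        = u a * (∏ i ∈ s, u i - ∏ i ∈ s, v i) + (u a - v a) * ∏ i ∈ s, v i := by ring
    rw [this]
    refine (norm_add_le _ _).trans ?_
    rw [norm_mul, norm_mul]
    nlinarith [norm_nonneg (u a), norm_nonneg (u a - v a),
      norm_nonneg (∏ i ∈ s, u i - ∏ i ∈ s, v i)]

theorem abs_exp_neg_sub_exp_neg_le {x y : ℝ} (hx : 0 ≤ x) (hy : 0 ≤ y) :
    |Real.exp (-x) - Real.exp (-y)| ≤ |x - y| := by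
  wlog h : x ≤ y generalizing x y
  · rw [abs_sub_comm, abs_sub_comm x]
    exact this hy hx (le_of_not_ge h)
  have h1 : Real.exp (-y) ≤ Real.exp (-x) := Real.exp_le_exp.mpr (by linarith)
  rw [abs_of_nonneg (by linarith), abs_of_nonpos (by linarith)]
  have h2 : Real.exp (-y) = Real.exp (-x) * Real.exp (-(y - x)) := by
    rw [← Real.exp_add]; ring_nf
  have h3 := Real.add_one_le_exp (-(y - x))
  have h4 : Real.exp (-x) ≤ 1 := Real.exp_le_one_iff.mpr (by linarith)
  rw [h2]
  nlinarith [Real.exp_pos (-x)]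

/-- With `V = ∑ x_i² / 2`, each `exp (i x_i)` is first traded for `(1 + i x_i) exp (-x_i² / 2)`;
both lie in the unit disc, so the errors merely add. Then `exp (-V)` is traded for the constant `exp
(-c)`, at cost `|V - c|` times the norm of the product, itself at most `exp V`. -/
theorem norm_exp_sum_sub_prod_le {ι : Type*} (s : Finset ι) (x : ι → ℝ)
    (hx : ∀ i ∈ s, |x i| ≤ 1) {c : ℝ} (hc : 0 ≤ c) :
    ‖Complex.exp ((∑ i ∈ s, x i : ℝ) * Complex.I)
        - Real.exp (-c) * ∏ i ∈ s, (1 + x i * Complex.I)‖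
      ≤ 4 * ∑ i ∈ s, |x i| ^ 3
        + Real.exp ((∑ i ∈ s, x i ^ 2) / 2) * |(∑ i ∈ s, x i ^ 2) / 2 - c| := by
  set V := (∑ i ∈ s, x i ^ 2) / 2 with hV
  have hV0 : 0 ≤ V := by positivity
  have hprod : ‖∏ i ∈ s, ((1 : ℂ) + x i * Complex.I)‖ ≤ Real.exp V := by
    rw [norm_prod, hV, Finset.sum_div, Real.exp_sum]
    exact Finset.prod_le_prod (fun i _ => norm_nonneg _) (fun i _ => norm_one_add_mul_I_le _)
  have e1 : Complex.exp ((∑ i ∈ s, x i : ℝ) * Complex.I)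
      = ∏ i ∈ s, Complex.exp (x i * Complex.I) := by
    rw [← Complex.exp_sum, Complex.ofReal_sum, Finset.sum_mul]
  have e2 : (Real.exp (-V) : ℂ) * ∏ i ∈ s, (1 + x i * Complex.I)
      = ∏ i ∈ s, ((1 + x i * Complex.I) * Complex.exp ((-(x i ^ 2 / 2) : ℝ))) := by
    rw [Finset.prod_mul_distrib, ← Complex.exp_sum, ← Complex.ofReal_sum, Finset.sum_neg_distrib,
      ← Finset.sum_div, ← hV, mul_comm, Complex.ofReal_exp]
  have h1 : ‖Complex.exp ((∑ i ∈ s, x i : ℝ) * Complex.I)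
      - Real.exp (-V) * ∏ i ∈ s, (1 + x i * Complex.I)‖ ≤ 4 * ∑ i ∈ s, |x i| ^ 3 := by
    rw [e1, e2, Finset.mul_sum]
    refine (norm_prod_sub_prod_le _ _ _ (fun i _ => ?_) (fun i _ => ?_)).trans
      (Finset.sum_le_sum fun i hi => norm_exp_mul_I_sub_le (hx i hi))
    · rw [Complex.norm_exp_ofReal_mul_I]
    · rw [norm_mul, ← Complex.ofReal_exp, Complex.norm_real, Real.norm_eq_abs, Real.abs_exp,
        Real.exp_neg, ← div_eq_mul_inv]
      exact div_le_one_of_le₀ (norm_one_add_mul_I_le _) (Real.exp_nonneg _)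
  have h2 : ‖((Real.exp (-V) : ℂ) - Real.exp (-c)) * ∏ i ∈ s, (1 + x i * Complex.I)‖
      ≤ Real.exp V * |V - c| := by
    rw [norm_mul, mul_comm, ← Complex.ofReal_sub, Complex.norm_real, Real.norm_eq_abs]
    exact mul_le_mul hprod (abs_exp_neg_sub_exp_neg_le hV0 hc) (abs_nonneg _) (Real.exp_nonneg _)
  have e3 : Complex.exp ((∑ i ∈ s, x i : ℝ) * Complex.I)
        - Real.exp (-c) * ∏ i ∈ s, (1 + x i * Complex.I)
      = (Complex.exp ((∑ i ∈ s, x i : ℝ) * Complex.I)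
        - Real.exp (-V) * ∏ i ∈ s, (1 + x i * Complex.I))
        + ((Real.exp (-V) : ℂ) - Real.exp (-c)) * ∏ i ∈ s, (1 + x i * Complex.I) := by ring
  rw [e3]
  exact (norm_add_le _ _).trans (add_le_add h1 h2)

/-! ### Characters and integrals over a period -/

/-- The character `x ↦ exp (2 π i x)`. -/
def cis (x : ℝ) : ℂ := Complex.exp ((2 * Real.pi * x : ℝ) * Complex.I)

theorem cis_add (x y : ℝ) : cis (x + y) = cis x * cis y := by
  rw [cis, cis, cis, ← Complex.exp_add]
  push_cast
  ring_nf

theorem cis_zero : cis 0 = 1 := by simp [cis]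

theorem cis_intCast (n : ℤ) : cis n = 1 := by
  rw [cis, Complex.exp_eq_one_iff]
  exact ⟨n, by push_cast; ring⟩

theorem norm_cis (x : ℝ) : ‖cis x‖ = 1 := Complex.norm_exp_ofReal_mul_I _

theorem conj_cis (x : ℝ) : (starRingEnd ℂ) (cis x) = cis (-x) := by
  rw [cis, cis, ← Complex.exp_conj, map_mul, Complex.conj_ofReal, Complex.conj_I]
  push_cast
  ring_nf

@[fun_prop]
theorem continuous_cis : Continuous cis := by unfold cis; fun_prop

theorem cis_eq_one_iff (x : ℝ) : cis x = 1 ↔ ∃ n : ℤ, x = n := by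
  constructor
  · intro h
    rw [cis, Complex.exp_eq_one_iff] at h
    obtain ⟨n, hn⟩ := h
    refine ⟨n, ?_⟩
    have h2 : (2 * Real.pi * Complex.I) * (x : ℂ) = (2 * Real.pi * Complex.I) * (n : ℂ) := by
      rw [mul_comm _ (n : ℂ), ← hn]; push_cast; ring
    have := mul_left_cancel₀ Complex.two_pi_I_ne_zero h2
    exact_mod_cast this
  · rintro ⟨n, rfl⟩
    exact cis_intCast n

theorem cis_int_mul_periodic (n : ℤ) : Function.Periodic (fun x : ℝ => cis (n * x)) 1 := by
  intro x
  simp only [mul_add, mul_one, cis_add, cis_intCast]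

theorem norm_cis_sub_le (x y : ℝ) : ‖cis x - cis y‖ ≤ 2 * Real.pi * |x - y| := by
  have h : cis x - cis y = cis y * (Complex.exp (Complex.I * (2 * Real.pi * (x - y) : ℝ)) - 1) := by
    have : cis x = cis (y + (x - y)) := by ring_nf
    rw [this, cis_add, mul_sub, mul_one]
    congr 2
    rw [cis, mul_comm]
  rw [h, norm_mul, norm_cis, one_mul]
  refine (Real.norm_exp_I_mul_ofReal_sub_one_le).trans (le_of_eq ?_)
  rw [Real.norm_eq_abs, abs_mul, abs_of_pos Real.two_pi_pos]

theorem periodic_comp_mul {α : Type*} {G : ℝ → α} (hG : Function.Periodic G 1) (b : ℕ) :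
    Function.Periodic (fun x => G (b * x)) 1 := by
  intro x
  have := hG.nat_mul b (b * x)
  simpa [mul_add] using this

theorem integral_periodic_add {G : ℝ → ℂ} (hG : Function.Periodic G 1) (s : ℝ) :
    ∫ x in (0 : ℝ)..1, G (x + s) = ∫ x in (0 : ℝ)..1, G x := by
  rw [intervalIntegral.integral_comp_add_right]
  have := hG.intervalIntegral_add_eq s 0
  simpa [add_comm] using this

/-- Translation by `1 / b` preserves the integral over a period and fixes `G (b x)`, but multiplies
the integrand by `cis (n / b) ≠ 1`. This is the martingale difference property. -/
theorem integral_cis_mul_comp_mul {b : ℕ} (hb : b ≠ 0) {n : ℤ} (hn : ¬ (b : ℤ) ∣ n) {G : ℝ → ℂ}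
    (hG : Function.Periodic G 1) : ∫ x in (0 : ℝ)..1, cis (n * x) * G (b * x) = 0 := by
  have hb' : (b : ℝ) ≠ 0 := by exact_mod_cast hb
  have hper : Function.Periodic (fun x : ℝ => cis (n * x) * G (b * x)) 1 :=
    (cis_int_mul_periodic n).mul (periodic_comp_mul hG b)
  have h := integral_periodic_add hper (1 / b)
  have h2 : ∀ x : ℝ, cis (n * (x + 1 / b)) * G (b * (x + 1 / b))
      = cis (n / b) * (cis (n * x) * G (b * x)) := by
    intro x
    have e1 : (b : ℝ) * (x + 1 / b) = b * x + 1 := by field_simp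
    have e2 : (n : ℝ) * (x + 1 / b) = n / b + n * x := by ring
    rw [e1, e2, hG, cis_add, mul_assoc]
  simp only [h2] at h
  rw [intervalIntegral.integral_const_mul] at h
  have h3 : cis (n / b) ≠ 1 := by
    rw [Ne, cis_eq_one_iff]
    rintro ⟨k, hk⟩
    apply hn
    refine ⟨k, ?_⟩
    rw [div_eq_iff hb'] at hk
    rw [mul_comm]
    exact_mod_cast hk
  by_contra h4
  exact h3 (mul_right_cancel₀ h4 (by rw [h, one_mul]))

theorem integral_cis_int_mul (n : ℤ) :
    ∫ x in (0 : ℝ)..1, cis (n * x) = if n = 0 then 1 else 0 := by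
  split_ifs with h
  · simp [h, cis_zero]
  -- Any modulus not dividing `n` would do; `2 |n|` is one, and `G = 1`.
  · have hb : n.natAbs * 2 ≠ 0 := by omega
    have hd : ¬ ((n.natAbs * 2 : ℕ) : ℤ) ∣ n := by
      intro h1
      have := Int.natAbs_dvd_natAbs.mpr h1
      have := Nat.le_of_dvd (by omega) this
      omega
    have := integral_cis_mul_comp_mul hb hd (G := fun _ => 1) (fun _ => rfl)
    simpa using this

theorem integral_comp_mul_of_periodic {G : ℝ → ℂ} (hG : Function.Periodic G 1)
    (hc : Continuous G) {b : ℕ} (hb : b ≠ 0) :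
    ∫ x in (0 : ℝ)..1, G (b * x) = ∫ x in (0 : ℝ)..1, G x := by
  have hb' : (b : ℝ) ≠ 0 := by exact_mod_cast hb
  rw [intervalIntegral.integral_comp_mul_left _ hb']
  have := hG.intervalIntegral_add_zsmul_eq b 0 (fun t₁ t₂ => hc.intervalIntegrable _ _)
  simp at this
  rw [mul_zero, mul_one, this, Complex.real_smul]
  push_cast
  rw [inv_mul_cancel_left₀ (by exact_mod_cast hb)]

/-! ### Mean values of lacunary products and averages -/

/-- For a trigonometric polynomial `f` without frequencies divisible by `b`, the functions
`f (b ^ k x)` are reversed martingale differences, so that such products have mean `1`. -/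
theorem integral_prod_one_add {b : ℕ} (hb : b ≠ 0) {ι : Type*} [Fintype ι] (d : ι → ℂ) (n : ι → ℤ)
    (hn : ∀ a, ¬ (b : ℤ) ∣ n a) (m : ℕ) :
    ∫ x in (0 : ℝ)..1, ∏ k ∈ Finset.range m, (1 + ∑ a, d a * cis (n a * ((b : ℝ) ^ k * x))) = 1 := by
  induction m with
  | zero => simp
  | succ m ih =>
    set G : ℝ → ℂ := fun y =>
      ∏ k ∈ Finset.range m, (1 + ∑ a, d a * cis (n a * ((b : ℝ) ^ k * y))) with hG
    have hper : Function.Periodic G 1 := by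
      intro y
      refine Finset.prod_congr rfl fun k _ => ?_
      congr 1
      refine Finset.sum_congr rfl fun a _ => ?_
      have := periodic_comp_mul (cis_int_mul_periodic (n a)) (b ^ k) y
      push_cast at this
      rw [this]
    have hc : Continuous G := by fun_prop
    have e : ∀ x : ℝ, ∏ k ∈ Finset.range (m + 1), (1 + ∑ a, d a * cis (n a * ((b : ℝ) ^ k * x)))
        = G (b * x) + ∑ a, d a * (cis (n a * x) * G (b * x)) := by
      intro x
      -- The factor `k = 0` is split off, so that all the others depend on `x` through `b x` only.
      rw [Finset.prod_range_succ']
      have : ∀ k, (b : ℝ) ^ (k + 1) * x = b ^ k * (b * x) := fun k => by ring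
      simp only [this, pow_zero, one_mul, hG]
      rw [mul_add, mul_one, Finset.mul_sum]
      congr 1
      exact Finset.sum_congr rfl fun a _ => by ring
    simp only [e]
    rw [intervalIntegral.integral_add, intervalIntegral.integral_finsetSum,
      integral_comp_mul_of_periodic hper hc hb, ih]
    · simp [intervalIntegral.integral_const_mul, integral_cis_mul_comp_mul hb (hn _) hper]
    · exact fun a _ => (by fun_prop : Continuous _).intervalIntegrable _ _
    · exact (by fun_prop : Continuous _).intervalIntegrable _ _
    · exact (by fun_prop : Continuous _).intervalIntegrable _ _

/-- Orthogonality: the frequencies `n b ^ k` are pairwise distinct. -/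
theorem integral_norm_sum_cis_sq {b : ℕ} (hb : 2 ≤ b) {n : ℤ} (hn : n ≠ 0) (m : ℕ) :
    ∫ x in (0 : ℝ)..1, ‖∑ k ∈ Finset.range m, cis (n * ((b : ℝ) ^ k * x))‖ ^ 2 = m := by
  have e : ∀ x : ℝ, ((‖∑ k ∈ Finset.range m, cis (n * ((b : ℝ) ^ k * x))‖ ^ 2 : ℝ) : ℂ)
      = ∑ k ∈ Finset.range m, ∑ l ∈ Finset.range m,
        cis ((n * ((b : ℤ) ^ k - (b : ℤ) ^ l) : ℤ) * x) := by
    intro x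
    push_cast
    rw [← Complex.mul_conj', map_sum, Finset.sum_mul_sum]
    refine Finset.sum_congr rfl fun k _ => Finset.sum_congr rfl fun l _ => ?_
    rw [conj_cis, ← cis_add]
    congr 1
    ring
  have h : ((∫ x in (0 : ℝ)..1, ‖∑ k ∈ Finset.range m, cis (n * ((b : ℝ) ^ k * x))‖ ^ 2 : ℝ) : ℂ)
      = m := by
    rw [← intervalIntegral.integral_ofReal]
    simp only [e]
    rw [intervalIntegral.integral_finsetSum]
    · have : ∀ k ∈ Finset.range m, ∫ x in (0 : ℝ)..1, ∑ l ∈ Finset.range m,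
          cis ((n * ((b : ℤ) ^ k - (b : ℤ) ^ l) : ℤ) * x) = 1 := by
        intro k hk
        rw [intervalIntegral.integral_finsetSum]
        · have h0 : ∀ l, (n * ((b : ℤ) ^ k - (b : ℤ) ^ l) = 0) ↔ k = l := by
            intro l
            rw [mul_eq_zero, or_iff_right hn, sub_eq_zero]
            exact ⟨fun h => Nat.pow_right_injective hb (by exact_mod_cast h), fun h => by rw [h]⟩
          simp only [integral_cis_int_mul, h0]
          rw [Finset.sum_ite_eq, if_pos hk]
        · exact fun a _ => (by fun_prop : Continuous _).intervalIntegrable _ _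
      rw [Finset.sum_congr rfl this]
      simp
    · exact fun a _ => (by fun_prop : Continuous _).intervalIntegrable _ _
  exact_mod_cast h

theorem integral_norm_average_cis_le {b : ℕ} (hb : 2 ≤ b) {n : ℤ} (hn : n ≠ 0) {m : ℕ}
    (hm : m ≠ 0) :
    ∫ x in (0 : ℝ)..1, ‖(1 / (m : ℂ)) * ∑ k ∈ Finset.range m, cis (n * ((b : ℝ) ^ k * x))‖
      ≤ 1 / √(m : ℝ) := by
  have hm' : (0 : ℝ) < m := by exact_mod_cast Nat.pos_of_ne_zero hm
  set r := √(m : ℝ) with hr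
  have hr0 : 0 < r := Real.sqrt_pos.mpr hm'
  have hrr : r * r = m := Real.mul_self_sqrt hm'.le
  -- The inequality `2 z r ≤ z² + r²` with `r = √m` replaces Cauchy-Schwarz: after integration both
  -- terms equal `1 / (2 r)`.
  have h : ∀ x : ℝ, ‖(1 / (m : ℂ)) * ∑ k ∈ Finset.range m, cis (n * ((b : ℝ) ^ k * x))‖
      ≤ 1 / (2 * r) + 1 / (2 * (r * m)) *
        ‖∑ k ∈ Finset.range m, cis (n * ((b : ℝ) ^ k * x))‖ ^ 2 := by
    intro x
    set z := ‖∑ k ∈ Finset.range m, cis (n * ((b : ℝ) ^ k * x))‖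
    rw [norm_mul]
    have : ‖(1 / (m : ℂ))‖ = 1 / (r * r) := by rw [hrr]; simp
    rw [this, ← hrr]
    have h2 : 1 / (2 * r) + 1 / (2 * (r * (r * r))) * z ^ 2 - 1 / (r * r) * z
        = (z - r) ^ 2 / (2 * (r * (r * r))) := by
      field_simp
      ring
    have h3 : 0 ≤ (z - r) ^ 2 / (2 * (r * (r * r))) := by positivity
    linarith
  calc _ ≤ ∫ x in (0 : ℝ)..1, (1 / (2 * r) + 1 / (2 * (r * m)) *
        ‖∑ k ∈ Finset.range m, cis (n * ((b : ℝ) ^ k * x))‖ ^ 2) := by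
        refine intervalIntegral.integral_mono_on (by norm_num) ?_ ?_ (fun x _ => h x) <;>
        exact (by fun_prop : Continuous _).intervalIntegrable _ _
    _ = 1 / r := by
        rw [intervalIntegral.integral_add, intervalIntegral.integral_const_mul,
          integral_norm_sum_cis_sq hb hn]
        · simp
          field_simp
          norm_num
        · exact (by fun_prop : Continuous _).intervalIntegrable _ _
        · exact (by fun_prop : Continuous _).intervalIntegrable _ _

/-- The ergodic averages of a trigonometric polynomial along `x ↦ b ^ k x` converge in `L¹`. -/
theorem integral_norm_average_sub_le {b : ℕ} (hb : 2 ≤ b) {ι : Type*} [Fintype ι] (d : ι → ℂ)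
    (n : ι → ℤ) {m : ℕ} (hm : m ≠ 0) :
    ∫ x in (0 : ℝ)..1, ‖(1 / (m : ℂ)) * ∑ k ∈ Finset.range m,
        ∑ a, d a * cis (n a * ((b : ℝ) ^ k * x)) - ∑ a, if n a = 0 then d a else 0‖
      ≤ (∑ a, ‖d a‖) / √(m : ℝ) := by
  have hm' : (m : ℂ) ≠ 0 := by exact_mod_cast hm
  have e : ∀ x : ℝ, ‖(1 / (m : ℂ)) * ∑ k ∈ Finset.range m,
        ∑ a, d a * cis (n a * ((b : ℝ) ^ k * x)) - ∑ a, if n a = 0 then d a else 0‖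
      ≤ ∑ a, ‖d a‖ * (if n a = 0 then 0 else
        ‖(1 / (m : ℂ)) * ∑ k ∈ Finset.range m, cis (n a * ((b : ℝ) ^ k * x))‖) := by
    intro x
    rw [Finset.sum_comm, Finset.mul_sum, ← Finset.sum_sub_distrib]
    refine (norm_sum_le _ _).trans (Finset.sum_le_sum fun a _ => ?_)
    split_ifs with h
    · simp [h, cis_zero, hm']
    · rw [sub_zero, ← Finset.mul_sum, mul_left_comm, norm_mul]
  have hcont : ∀ a, Continuous (fun x : ℝ => ‖d a‖ * (if n a = 0 then 0 else
        ‖(1 / (m : ℂ)) * ∑ k ∈ Finset.range m, cis (n a * ((b : ℝ) ^ k * x))‖)) := by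
    intro a
    split_ifs <;> fun_prop
  calc _ ≤ ∫ x in (0 : ℝ)..1, ∑ a, ‖d a‖ * (if n a = 0 then 0 else
        ‖(1 / (m : ℂ)) * ∑ k ∈ Finset.range m, cis (n a * ((b : ℝ) ^ k * x))‖) := by
        refine intervalIntegral.integral_mono_on (by norm_num) ?_ ?_ (fun x _ => e x)
        · exact (by fun_prop : Continuous _).intervalIntegrable _ _
        · exact (continuous_finsetSum _ fun a _ => hcont a).intervalIntegrable _ _
    _ ≤ _ := by
        rw [intervalIntegral.integral_finsetSum fun a _ => (hcont a).intervalIntegrable _ _,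
          Finset.sum_div]
        refine Finset.sum_le_sum fun a _ => ?_
        rw [intervalIntegral.integral_const_mul, div_eq_mul_one_div ‖d a‖]
        refine mul_le_mul_of_nonneg_left ?_ (norm_nonneg _)
        split_ifs with h
        · simp
        · exact integral_norm_average_cis_le hb h hm

/-! ### Central limit theorem for lacunary trigonometric polynomials -/

/-- The hypothesis `hv` says that `v` is the constant term of `f²`. With `C = ∑ ‖d a‖` bounding
`|f|`, the condition `C ≤ √m` makes every summand at most `1` in absolute value, the sum of squares
is at most `C²` and the sum of cubes at most `C³ / √m`. -/
theorem norm_integral_exp_sum_sub_le {b : ℕ} (hb : 2 ≤ b) {ι : Type*} [Fintype ι] (d : ι → ℂ)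
    (n : ι → ℤ) (hn : ∀ a, ¬ (b : ℤ) ∣ n a) (f : ℝ → ℝ)
    (hf : ∀ x, (f x : ℂ) = ∑ a, d a * cis (n a * x)) {v : ℝ} (hv0 : 0 ≤ v)
    (hv : (v : ℂ) = ∑ p : ι × ι, if n p.1 + n p.2 = 0 then d p.1 * d p.2 else 0)
    {m : ℕ} (hm0 : m ≠ 0) (hm : (∑ a, ‖d a‖) ≤ √(m : ℝ)) :
    ‖(∫ x in (0 : ℝ)..1,
        Complex.exp ((1 / √(m : ℝ) * ∑ k ∈ Finset.range m, f ((b : ℝ) ^ k * x) : ℝ) * Complex.I))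
      - Real.exp (-(v / 2))‖
    ≤ (4 * (∑ a, ‖d a‖) ^ 3 + Real.exp ((∑ a, ‖d a‖) ^ 2 / 2) / 2 *
        ∑ p : ι × ι, ‖d p.1 * d p.2‖) / √(m : ℝ) := by
  set C := ∑ a, ‖d a‖ with hC
  have hC0 : 0 ≤ C := by positivity
  have hm' : (0 : ℝ) < m := by exact_mod_cast Nat.pos_of_ne_zero hm0
  set r := √(m : ℝ) with hr
  have hr0 : 0 < r := Real.sqrt_pos.mpr hm'
  have hrr : r ^ 2 = m := Real.sq_sqrt hm'.le
  have hfC : ∀ x, |f x| ≤ C := by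
    intro x
    rw [← Real.norm_eq_abs, ← Complex.norm_real, hf]
    refine (norm_sum_le _ _).trans (le_of_eq ?_)
    simp [norm_cis, hC]
  have hfc : Continuous f := by
    have : Continuous (fun x => (∑ a, d a * cis (n a * x)).re) := by fun_prop
    refine this.congr fun x => ?_
    rw [← hf, Complex.ofReal_re]
  set y : ℕ → ℝ → ℝ := fun k x => 1 / r * f ((b : ℝ) ^ k * x) with hy
  have hyc : ∀ k, Continuous (y k) := fun k => by fun_prop
  have hyb : ∀ k x, |y k x| ≤ C / r := by
    intro k x
    rw [hy, abs_mul, abs_of_pos (by positivity), one_div, inv_mul_eq_div]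
    gcongr
    exact hfC _
  have hcr : C / r ≤ 1 := (div_le_one hr0).mpr hm
  have hV : ∀ x, ∑ k ∈ Finset.range m, y k x ^ 2 ≤ C ^ 2 := by
    intro x
    calc ∑ k ∈ Finset.range m, y k x ^ 2 ≤ ∑ k ∈ Finset.range m, (C / r) ^ 2 := by
          refine Finset.sum_le_sum fun k _ => ?_
          rw [← sq_abs]
          exact pow_le_pow_left₀ (abs_nonneg _) (hyb k x) 2
      _ = C ^ 2 := by
          rw [Finset.sum_const, Finset.card_range, nsmul_eq_mul, div_pow, hrr]
          field_simp
  have h3 : ∀ x, ∑ k ∈ Finset.range m, |y k x| ^ 3 ≤ C ^ 3 / r := by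
    intro x
    calc ∑ k ∈ Finset.range m, |y k x| ^ 3 ≤ ∑ k ∈ Finset.range m, (C / r) ^ 3 := by
          refine Finset.sum_le_sum fun k _ => ?_
          exact pow_le_pow_left₀ (abs_nonneg _) (hyb k x) 3
      _ = C ^ 3 / r := by
          rw [Finset.sum_const, Finset.card_range, nsmul_eq_mul, ← hrr]
          field_simp
  -- The factor `i / √m` is absorbed into the coefficients; the frequencies do not change.
  have hprod : ∫ x in (0 : ℝ)..1, ∏ k ∈ Finset.range m, ((1 : ℂ) + y k x * Complex.I) = 1 := by
    refine Eq.trans (intervalIntegral.integral_congr fun x _ =>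
      Finset.prod_congr rfl fun k _ => ?_)
      (integral_prod_one_add (by omega : b ≠ 0) (fun a => Complex.I / r * d a) n hn m)
    simp only [hy, mul_assoc, ← Finset.mul_sum]
    rw [← hf]
    push_cast
    ring
  -- The square of `f` is a trigonometric polynomial with frequencies `n a + n a'`, so the sum of
  -- squares is an ergodic average.
  have hvar : ∀ x, ((∑ k ∈ Finset.range m, y k x ^ 2 : ℝ) : ℂ)
      = 1 / (m : ℂ) * ∑ k ∈ Finset.range m,
        ∑ p : ι × ι, (d p.1 * d p.2) * cis ((n p.1 + n p.2 : ℤ) * ((b : ℝ) ^ k * x)) := by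
    intro x
    push_cast
    rw [Finset.mul_sum]
    refine Finset.sum_congr rfl fun k _ => ?_
    have e : (y k x : ℂ) ^ 2 = 1 / m * ((f ((b : ℝ) ^ k * x) : ℂ) * f ((b : ℝ) ^ k * x)) := by
      have : (m : ℂ) = (r : ℂ) ^ 2 := by exact_mod_cast hrr.symm
      simp only [hy, this]
      push_cast
      ring
    rw [e, hf, Finset.sum_mul_sum, Fintype.sum_prod_type]
    congr 1
    refine Finset.sum_congr rfl fun a _ => Finset.sum_congr rfl fun a' _ => ?_
    rw [add_mul, cis_add]
    ring
  have hL1 : ∫ x in (0 : ℝ)..1, |(∑ k ∈ Finset.range m, y k x ^ 2) - v|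
      ≤ (∑ p : ι × ι, ‖d p.1 * d p.2‖) / r := by
    have h := integral_norm_average_sub_le hb (fun p : ι × ι => d p.1 * d p.2)
      (fun p => n p.1 + n p.2) hm0
    refine le_trans (le_of_eq ?_) h
    congr 1
    ext x
    rw [← hv, ← hvar, ← Complex.ofReal_sub, Complex.norm_real, Real.norm_eq_abs]
  have hpt : ∀ x, ‖Complex.exp ((1 / r * ∑ k ∈ Finset.range m, f ((b : ℝ) ^ k * x) : ℝ) * Complex.I)
        - Real.exp (-(v / 2)) * ∏ k ∈ Finset.range m, ((1 : ℂ) + y k x * Complex.I)‖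
      ≤ 4 * C ^ 3 / r
        + Real.exp (C ^ 2 / 2) / 2 * |(∑ k ∈ Finset.range m, y k x ^ 2) - v| := by
    intro x
    have h := norm_exp_sum_sub_prod_le (Finset.range m) (fun k => y k x)
      (fun k _ => (hyb k x).trans hcr) (c := v / 2) (by positivity)
    have e : 1 / r * ∑ k ∈ Finset.range m, f ((b : ℝ) ^ k * x) = ∑ k ∈ Finset.range m, y k x := by
      rw [Finset.mul_sum]
    rw [e]
    refine h.trans (add_le_add ?_ ?_)
    · rw [mul_div_assoc]
      gcongr
      exact h3 x
    · rw [← sub_div, abs_div, abs_of_pos (two_pos : (0 : ℝ) < 2), ← mul_div_assoc, div_mul_eq_mul_div]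
      gcongr
      exact hV x
  -- The product has integral `1`, so the limit can be moved under the integral sign.
  have hsub : (∫ x in (0 : ℝ)..1,
        Complex.exp ((1 / r * ∑ k ∈ Finset.range m, f ((b : ℝ) ^ k * x) : ℝ) * Complex.I))
      - Real.exp (-(v / 2))
      = ∫ x in (0 : ℝ)..1,
        (Complex.exp ((1 / r * ∑ k ∈ Finset.range m, f ((b : ℝ) ^ k * x) : ℝ) * Complex.I)
        - Real.exp (-(v / 2)) * ∏ k ∈ Finset.range m, ((1 : ℂ) + y k x * Complex.I)) := by
    rw [intervalIntegral.integral_sub, intervalIntegral.integral_const_mul, hprod, mul_one]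
    · exact (by fun_prop : Continuous _).intervalIntegrable _ _
    · exact (by fun_prop : Continuous _).intervalIntegrable _ _
  rw [hsub]
  calc _ ≤ ∫ x in (0 : ℝ)..1, (4 * C ^ 3 / r
        + Real.exp (C ^ 2 / 2) / 2 * |(∑ k ∈ Finset.range m, y k x ^ 2) - v|) := by
        refine intervalIntegral.norm_integral_le_of_norm_le (by norm_num) ?_ ?_
        · exact .of_forall fun x _ => hpt x
        · exact (by fun_prop : Continuous _).intervalIntegrable _ _
    _ ≤ _ := by
        rw [intervalIntegral.integral_add, intervalIntegral.integral_const_mul, add_div,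
          mul_div_assoc (_ / 2)]
        · refine add_le_add (by simp) ?_
          gcongr
        · exact (by fun_prop : Continuous _).intervalIntegrable _ _
        · exact (by fun_prop : Continuous _).intervalIntegrable _ _

/-- Central limit theorem for lacunary trigonometric polynomials, at the level of characteristic
functions. -/
theorem tendsto_integral_exp_sum {b : ℕ} (hb : 2 ≤ b) {ι : Type*} [Fintype ι] (d : ι → ℂ)
    (n : ι → ℤ) (hn : ∀ a, ¬ (b : ℤ) ∣ n a) (f : ℝ → ℝ)
    (hf : ∀ x, (f x : ℂ) = ∑ a, d a * cis (n a * x)) {v : ℝ} (hv0 : 0 ≤ v)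
    (hv : (v : ℂ) = ∑ p : ι × ι, if n p.1 + n p.2 = 0 then d p.1 * d p.2 else 0) :
    Tendsto (fun m : ℕ => ∫ x in (0 : ℝ)..1,
        Complex.exp ((1 / √(m : ℝ) * ∑ k ∈ Finset.range m, f ((b : ℝ) ^ k * x) : ℝ) * Complex.I))
      atTop (𝓝 (Real.exp (-(v / 2)) : ℂ)) := by
  have hs : Tendsto (fun m : ℕ => √(m : ℝ)) atTop atTop :=
    Real.tendsto_sqrt_atTop.comp tendsto_natCast_atTop_atTop
  rw [tendsto_iff_norm_sub_tendsto_zero]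
  refine squeeze_zero' (g := fun m : ℕ => (4 * (∑ a, ‖d a‖) ^ 3 +
    Real.exp ((∑ a, ‖d a‖) ^ 2 / 2) / 2 * ∑ p : ι × ι, ‖d p.1 * d p.2‖) / √(m : ℝ))
    (.of_forall fun _ => norm_nonneg _) ?_ (Tendsto.const_div_atTop hs _)
  filter_upwards [eventually_ne_atTop 0, hs.eventually_ge_atTop (∑ a, ‖d a‖)] with m h0 h1
  exact norm_integral_exp_sum_sub_le hb d n hn f hf hv0 hv h0 h1

/-! ### Complex normal and chi-square laws -/

theorem integral_cexp_sq_gaussianReal_half (t : ℝ) :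
    ∫ x, Complex.exp ((2 * t * x ^ 2 : ℝ) * Complex.I) ∂gaussianReal 0 (1 / 2)
      = ∫ x, Complex.exp ((t * x ^ 2 : ℝ) * Complex.I) ∂gaussianReal 0 1 := by
  have h : (gaussianReal 0 (1 / 2)).map (√2 * ·) = gaussianReal 0 1 := by
    rw [gaussianReal_map_const_mul, mul_zero]
    congr 1
    ext
    simp
  rw [← h, integral_map (by fun_prop) (by fun_prop : Continuous _).aestronglyMeasurable]
  congr 1
  ext x
  rw [mul_pow, Real.sq_sqrt (by norm_num)]
  congr 3
  ring

theorem integral_cexp_normSq_complexNormal (t : ℝ) :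
    ∫ z, Complex.exp ((t * (2 * ‖z‖ ^ 2) : ℝ) * Complex.I) ∂complexNormal
      = (∫ x, Complex.exp ((t * x ^ 2 : ℝ) * Complex.I) ∂gaussianReal 0 1) ^ 2 := by
  rw [complexNormal, integral_map (by fun_prop) (by fun_prop : Continuous _).aestronglyMeasurable,
    sq, ← integral_cexp_sq_gaussianReal_half, ← integral_prod_mul]
  congr 1
  ext p
  rw [← Complex.exp_add, ← Complex.normSq_eq_norm_sq, Complex.normSq_add_mul_I]
  congr 1
  push_cast
  ring

/-- Each `2 |z_i|²` is `(√2 X)² + (√2 Y)²`, a sum of two independent squared standard normals; both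
characteristic functions are thus the same power of one Gaussian integral. -/
theorem map_two_mul_sum_normSq_stdComplexNormal (n : ℕ) :
    (stdComplexNormal n).map (fun z => 2 * ∑ i, ‖z i‖ ^ 2) = chiSquare (2 * n) := by
  have hm : Measurable fun z : Fin n → ℂ => 2 * ∑ i, ‖z i‖ ^ 2 :=
    (by fun_prop : Continuous _).measurable
  have : IsProbabilityMeasure ((stdComplexNormal n).map (fun z => 2 * ∑ i, ‖z i‖ ^ 2)) :=
    Measure.isProbabilityMeasure_map hm.aemeasurable
  refine Measure.ext_of_charFun (funext fun t => ?_)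
  rw [charFun_apply_real, charFun_apply_real, chiSquare,
    integral_map hm.aemeasurable (by fun_prop : Continuous _).aestronglyMeasurable,
    integral_map (by fun_prop : Continuous _).measurable.aemeasurable
      (by fun_prop : Continuous _).aestronglyMeasurable]
  have e1 : ∀ z : Fin n → ℂ, Complex.exp (t * (2 * ∑ i, ‖z i‖ ^ 2 : ℝ) * Complex.I)
      = ∏ i, Complex.exp ((t * (2 * ‖z i‖ ^ 2) : ℝ) * Complex.I) := by
    intro z
    rw [← Complex.exp_sum]
    congr 1
    push_cast
    rw [← Finset.sum_mul, ← Finset.mul_sum, ← Finset.mul_sum]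
  have e2 : ∀ x : Fin (2 * n) → ℝ, Complex.exp (t * (∑ i, x i ^ 2 : ℝ) * Complex.I)
      = ∏ i, Complex.exp ((t * x i ^ 2 : ℝ) * Complex.I) := by
    intro x
    rw [← Complex.exp_sum]
    congr 1
    push_cast
    rw [← Finset.sum_mul, ← Finset.mul_sum]
  simp only [e1, e2]
  rw [stdComplexNormal,
    integral_fintype_prod_eq_pow (fun z : ℂ => Complex.exp ((t * (2 * ‖z‖ ^ 2) : ℝ) * Complex.I)),
    integral_fintype_prod_eq_pow (fun x : ℝ => Complex.exp ((t * x ^ 2 : ℝ) * Complex.I)),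
    integral_cexp_normSq_complexNormal, ← pow_mul, Fintype.card_fin, Fintype.card_fin]

theorem charFun_complexNormal (w : ℂ) :
    charFun complexNormal w = Real.exp (-(‖w‖ ^ 2 / 4)) := by
  rw [charFun_apply, complexNormal,
    integral_map (by fun_prop) (by fun_prop : Continuous _).aestronglyMeasurable]
  have e : ∀ p : ℝ × ℝ, Complex.exp ((inner ℝ ((p.1 : ℂ) + p.2 * Complex.I) w : ℝ) * Complex.I)
      = Complex.exp (w.re * p.1 * Complex.I) * Complex.exp (w.im * p.2 * Complex.I) := by
    intro p
    rw [← Complex.exp_add, Complex.inner]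
    congr 1
    simp
    ring
  simp only [e]
  rw [integral_prod_mul (fun x : ℝ => Complex.exp (w.re * x * Complex.I))
    (fun x : ℝ => Complex.exp (w.im * x * Complex.I)), ← charFun_apply_real, ← charFun_apply_real,
    charFun_gaussianReal, charFun_gaussianReal, ← Complex.exp_add, ← Complex.normSq_eq_norm_sq,
    Complex.normSq_apply]
  push_cast
  congr 1
  simp
  ring

theorem charFun_map_toLp_stdComplexNormal {n : ℕ} (w : EuclideanSpace ℂ (Fin n)) :
    charFun ((stdComplexNormal n).map (WithLp.toLp 2)) w
      = Real.exp (-((∑ i, ‖w i‖ ^ 2) / 4)) := by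
  rw [stdComplexNormal, charFun_pi]
  simp only [charFun_complexNormal]
  rw [← Complex.ofReal_prod, ← Real.exp_sum, Finset.sum_neg_distrib, Finset.sum_div]

/-! ### Replacing the truncation by the full expansion -/

variable (b : ℕ) [NeZero b]

theorem sum_Icc_one_eq_sum_range {M : Type*} [AddCommMonoid M] (f : ℕ → M) (m : ℕ) :
    ∑ t ∈ Finset.Icc 1 m, f t = ∑ k ∈ Finset.range m, f (k + 1) := by
  rw [Finset.range_eq_Ico, Finset.sum_Ico_add' f 0 m 1]
  rfl

theorem measurable_digitTrunc (m : ℕ) : Measurable (digitTrunc b m) := by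
  unfold digitTrunc digit Real.digits
  refine Finset.measurable_sum _ fun t _ => Measurable.div_const ?_ _
  have h : Measurable fun k : ℕ => (((Fin.ofNat b k : Fin b) : ℕ) : ℝ) := measurable_of_countable _
  exact h.comp (Nat.measurable_floor.comp (measurable_id.mul_const _))

theorem measurable_harmonicAverage (m j : ℕ) : Measurable (harmonicAverage b m j) := by
  unfold harmonicAverage harmonicComponent
  have := measurable_digitTrunc b m
  fun_prop

theorem measurable_scaledVector (m : ℕ) : Measurable (scaledVector b m) := by
  unfold scaledVector
  have := measurable_harmonicAverage b m
  fun_prop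

theorem abs_digitTrunc_sub_le {u : ℝ} (hu : u ∈ Set.Ico (0 : ℝ) 1) (m : ℕ) :
    |digitTrunc b m u - u| ≤ ((b : ℝ) ^ m)⁻¹ := by
  have e : digitTrunc b m u = ∑ k ∈ Finset.range m, Real.ofDigitsTerm (Real.digits u b) k := by
    rw [digitTrunc, sum_Icc_one_eq_sum_range]
    rfl
  have h1 := Real.sum_ofDigitsTerm_digits_le (b := b) hu m
  have h2 := Real.le_sum_ofDigitsTerm_digits (b := b) hu m
  rw [inv_pow] at h2
  rw [e, abs_le]
  constructor <;> linarith [inv_nonneg.mpr (show (0 : ℝ) ≤ (b : ℝ) ^ m by positivity)]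

theorem harmonicAverage_eq (m j : ℕ) (u : ℝ) :
    harmonicAverage b m j u
      = (1 / (m : ℂ)) * ∑ k ∈ Finset.range m, cis (j * ((b : ℝ) ^ k * digitTrunc b m u)) := by
  rw [harmonicAverage, sum_Icc_one_eq_sum_range]
  congr 1
  refine Finset.sum_congr rfl fun k _ => ?_
  rw [harmonicComponent, cis, freq, Nat.add_sub_cancel]
  congr 1
  push_cast
  ring

theorem sum_pow_mul_inv_pow_le {b : ℕ} (hb : 2 ≤ b) (m : ℕ) :
    ∑ k ∈ Finset.range m, (b : ℝ) ^ k * ((b : ℝ) ^ m)⁻¹ ≤ 1 := by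
  rw [← Finset.sum_mul, ← div_eq_mul_inv]
  refine div_le_one_of_le₀ ?_ (by positivity)
  have := (Nat.geomSum_lt hb (s := Finset.range m) (n := m) (by simp)).le
  exact_mod_cast this

/-- The `k`-th term moves by at most `2 π j b ^ (k - m)`, and these bounds sum to at most `2 π j`,
whatever `m` is. -/
theorem norm_sqrt_mul_harmonicAverage_sub_le (hb : 2 ≤ b) (m j : ℕ) {u : ℝ}
    (hu : u ∈ Set.Ico (0 : ℝ) 1) :
    ‖((√(m : ℝ) : ℝ) : ℂ) * harmonicAverage b m j u
      - ((1 / √(m : ℝ) : ℝ) : ℂ) * ∑ k ∈ Finset.range m, cis (j * ((b : ℝ) ^ k * u))‖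
      ≤ 2 * Real.pi * j / √(m : ℝ) := by
  have e : ((√(m : ℝ) : ℝ) : ℂ) * (1 / (m : ℂ)) = ((1 / √(m : ℝ) : ℝ) : ℂ) := by
    rw [one_div (√(m : ℝ)), ← Real.sqrt_div_self]
    push_cast
    ring
  rw [harmonicAverage_eq, ← mul_assoc, e, ← mul_sub, norm_mul, Complex.norm_real, Real.norm_eq_abs,
    abs_of_nonneg (by positivity), one_div, inv_mul_eq_div, ← Finset.sum_sub_distrib]
  gcongr
  calc _ ≤ ∑ k ∈ Finset.range m, 2 * Real.pi * j * ((b : ℝ) ^ k * ((b : ℝ) ^ m)⁻¹) := by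
        refine (norm_sum_le _ _).trans (Finset.sum_le_sum fun k _ => ?_)
        refine (norm_cis_sub_le _ _).trans ?_
        rw [← mul_sub, ← mul_sub, abs_mul, abs_mul, Nat.abs_cast, abs_pow, Nat.abs_cast, ← mul_assoc]
        have := abs_digitTrunc_sub_le b hu m
        gcongr
    _ ≤ 2 * Real.pi * j := by
        rw [← Finset.mul_sum]
        exact mul_le_of_le_one_right (by positivity) (sum_pow_mul_inv_pow_le hb m)

/-! ### Linear functionals of the vector as trigonometric polynomials -/

/-- The trigonometric polynomial `x ↦ ∑ i, ⟪exp (2 π i (i + 1) x), w i⟫`. -/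
def trigInner {n : ℕ} (w : EuclideanSpace ℂ (Fin n)) (x : ℝ) : ℝ :=
  ∑ i : Fin n, inner ℝ (cis (((i : ℕ) + 1 : ℕ) * x)) (w i)

theorem continuous_trigInner {n : ℕ} (w : EuclideanSpace ℂ (Fin n)) :
    Continuous (trigInner w) := by
  unfold trigInner
  fun_prop

/-- The coefficients of `trigInner w`. -/
def trigCoeff {n : ℕ} (w : EuclideanSpace ℂ (Fin n)) : Fin n ⊕ Fin n → ℂ :=
  Sum.elim (fun i => (starRingEnd ℂ) (w i) / 2) (fun i => w i / 2)

/-- The frequencies of `trigInner w`. -/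
def trigFreq (n : ℕ) : Fin n ⊕ Fin n → ℤ :=
  Sum.elim (fun i => (i : ℤ) + 1) (fun i => -((i : ℤ) + 1))

theorem trigInner_eq {n : ℕ} (w : EuclideanSpace ℂ (Fin n)) (x : ℝ) :
    (trigInner w x : ℂ) = ∑ a, trigCoeff w a * cis (trigFreq n a * x) := by
  rw [Fintype.sum_sum_type, ← Finset.sum_add_distrib, trigInner, Complex.ofReal_sum]
  refine Finset.sum_congr rfl fun i _ => ?_
  rw [Complex.inner, Complex.re_eq_add_conj, map_mul, Complex.conj_conj, conj_cis]
  simp only [trigCoeff, trigFreq, Sum.elim_inl, Sum.elim_inr]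
  push_cast
  rw [neg_mul]
  ring

/-- The restriction to the orders `1, …, b - 1` enters here. -/
theorem not_dvd_trigFreq {b : ℕ} (a : Fin (b - 1) ⊕ Fin (b - 1)) :
    ¬ (b : ℤ) ∣ trigFreq (b - 1) a := by
  have h : ∀ i : Fin (b - 1), ¬ (b : ℤ) ∣ (i : ℤ) + 1 := fun i hi => by
    have := Int.le_of_dvd (by omega) hi
    omega
  rcases a with i | i
  · exact h i
  · simp only [trigFreq, Sum.elim_inr, dvd_neg]
    exact h i

/-- Only the pairs `(j, -j)` and `(-j, j)` cancel, each contributing `|w_i|² / 4`. Hence distinct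
orders are uncorrelated, as are the real and imaginary parts of one order. -/
theorem sum_trigCoeff_mul {n : ℕ} (w : EuclideanSpace ℂ (Fin n)) :
    (((∑ i, ‖w i‖ ^ 2) / 2 : ℝ) : ℂ)
      = ∑ p : (Fin n ⊕ Fin n) × (Fin n ⊕ Fin n), if trigFreq n p.1 + trigFreq n p.2 = 0 then
        trigCoeff w p.1 * trigCoeff w p.2 else 0 := by
  have h1 : ∀ i j : Fin n, (i : ℤ) + 1 + ((j : ℤ) + 1) ≠ 0 := fun i j => by omega
  have h2 : ∀ i j : Fin n, -((i : ℤ) + 1) + -((j : ℤ) + 1) ≠ 0 := fun i j => by omega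
  have h3 : ∀ i j : Fin n, (i : ℤ) + 1 + -((j : ℤ) + 1) = 0 ↔ i = j := fun i j => by
    rw [Fin.ext_iff]; omega
  have h4 : ∀ i j : Fin n, -((i : ℤ) + 1) + ((j : ℤ) + 1) = 0 ↔ i = j := fun i j => by
    rw [Fin.ext_iff]; omega
  simp only [Fintype.sum_prod_type, Fintype.sum_sum_type, trigFreq, trigCoeff, Sum.elim_inl,
    Sum.elim_inr, h1, h2, h3, h4, if_false, Finset.sum_const_zero, Finset.sum_ite_eq,
    Finset.mem_univ, if_true, zero_add, add_zero]
  rw [← Finset.sum_add_distrib]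
  push_cast
  rw [Finset.sum_div]
  refine Finset.sum_congr rfl fun i _ => ?_
  rw [← Complex.mul_conj']
  ring

theorem abs_inner_scaledVector_sub_le (hb : 2 ≤ b) (w : EuclideanSpace ℂ (Fin (b - 1))) (m : ℕ)
    {u : ℝ} (hu : u ∈ Set.Ico (0 : ℝ) 1) :
    |inner ℝ (WithLp.toLp 2 (scaledVector b m u)) w
      - 1 / √(m : ℝ) * ∑ k ∈ Finset.range m, trigInner w ((b : ℝ) ^ k * u)|
      ≤ (∑ i : Fin (b - 1), 2 * Real.pi * ((i : ℕ) + 1 : ℕ) * ‖w i‖) / √(m : ℝ) := by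
  have e : inner ℝ (WithLp.toLp 2 (scaledVector b m u)) w
      - 1 / √(m : ℝ) * ∑ k ∈ Finset.range m, trigInner w ((b : ℝ) ^ k * u)
      = ∑ i : Fin (b - 1), inner ℝ (((√(m : ℝ) : ℝ) : ℂ) * harmonicAverage b m (i + 1) u
      - ((1 / √(m : ℝ) : ℝ) : ℂ) * ∑ k ∈ Finset.range m,
        cis (((i : ℕ) + 1 : ℕ) * ((b : ℝ) ^ k * u))) (w i) := by
    simp only [inner_sub_left, Finset.sum_sub_distrib]
    congr 1
    simp only [trigInner]
    rw [Finset.sum_comm, Finset.mul_sum]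
    refine Finset.sum_congr rfl fun i _ => ?_
    rw [← Complex.real_smul, real_inner_smul_left, sum_inner]
  rw [e, Finset.sum_div]
  refine (Finset.abs_sum_le_sum_abs _ _).trans (Finset.sum_le_sum fun i _ => ?_)
  refine (abs_real_inner_le_norm _ _).trans ?_
  rw [mul_div_right_comm]
  exact mul_le_mul_of_nonneg_right (norm_sqrt_mul_harmonicAverage_sub_le b hb m (i + 1) hu)
    (norm_nonneg _)

/-! ### Convergence in distribution -/

theorem norm_cexp_mul_I_sub_le (x y : ℝ) :
    ‖Complex.exp (x * Complex.I) - Complex.exp (y * Complex.I)‖ ≤ |x - y| := by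
  have h : Complex.exp (x * Complex.I) - Complex.exp (y * Complex.I)
      = Complex.exp (y * Complex.I) * (Complex.exp (Complex.I * (x - y : ℝ)) - 1) := by
    rw [mul_sub, mul_one, ← Complex.exp_add]
    congr 2
    push_cast
    ring
  rw [h, norm_mul, Complex.norm_exp_ofReal_mul_I, one_mul]
  exact Real.norm_exp_I_mul_ofReal_sub_one_le

theorem tendsto_integral_exp_inner_scaledVector (hb : 2 ≤ b)
    (w : EuclideanSpace ℂ (Fin (b - 1))) :
    Tendsto (fun m : ℕ => ∫ u in (0 : ℝ)..1,
        Complex.exp ((inner ℝ (WithLp.toLp 2 (scaledVector b m u)) w : ℝ) * Complex.I))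
      atTop (𝓝 (Real.exp (-((∑ i, ‖w i‖ ^ 2) / 4)) : ℂ)) := by
  have hs : Tendsto (fun m : ℕ => √(m : ℝ)) atTop atTop :=
    Real.tendsto_sqrt_atTop.comp tendsto_natCast_atTop_atTop
  have h := tendsto_integral_exp_sum hb (trigCoeff w) (trigFreq (b - 1)) not_dvd_trigFreq
    (trigInner w) (trigInner_eq w) (by positivity) (sum_trigCoeff_mul w)
  have e : (∑ i, ‖w i‖ ^ 2) / 2 / 2 = (∑ i, ‖w i‖ ^ 2) / 4 := by ring
  rw [e] at h
  have hmeas : ∀ m, Measurable fun u : ℝ => Complex.exp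
      ((inner ℝ (WithLp.toLp 2 (scaledVector b m u)) w : ℝ) * Complex.I) := by
    intro m
    have := measurable_scaledVector b m
    fun_prop
  have hint : ∀ m, IntervalIntegrable (fun u : ℝ => Complex.exp
      ((inner ℝ (WithLp.toLp 2 (scaledVector b m u)) w : ℝ) * Complex.I)) volume 0 1 := by
    intro m
    refine (intervalIntegrable_const (c := (1 : ℝ))).mono_fun (hmeas m).aestronglyMeasurable
      (.of_forall fun u => ?_)
    simp only [Complex.norm_exp_ofReal_mul_I, norm_one, le_refl]
  have hc := continuous_trigInner w
  have hdiff : Tendsto (fun m : ℕ => (∫ u in (0 : ℝ)..1,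
        Complex.exp ((inner ℝ (WithLp.toLp 2 (scaledVector b m u)) w : ℝ) * Complex.I))
      - ∫ u in (0 : ℝ)..1, Complex.exp ((1 / √(m : ℝ) *
        ∑ k ∈ Finset.range m, trigInner w ((b : ℝ) ^ k * u) : ℝ) * Complex.I)) atTop (𝓝 0) := by
    refine squeeze_zero_norm (a := fun m : ℕ =>
      (∑ i : Fin (b - 1), 2 * Real.pi * ((i : ℕ) + 1 : ℕ) * ‖w i‖) / √(m : ℝ)) (fun m => ?_)
      (Tendsto.const_div_atTop hs _)
    rw [← intervalIntegral.integral_sub (hint m)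
      ((by fun_prop : Continuous _).intervalIntegrable _ _)]
    have h1 := intervalIntegral.norm_integral_le_of_norm_le_const_ae (a := 0) (b := 1) (f := fun u =>
      Complex.exp ((inner ℝ (WithLp.toLp 2 (scaledVector b m u)) w : ℝ) * Complex.I)
      - Complex.exp ((1 / √(m : ℝ) *
        ∑ k ∈ Finset.range m, trigInner w ((b : ℝ) ^ k * u) : ℝ) * Complex.I))
      (C := (∑ i : Fin (b - 1), 2 * Real.pi * ((i : ℕ) + 1 : ℕ) * ‖w i‖) / √(m : ℝ)) ?_
    · simpa using h1
    -- The truncation bound needs `u < 1`; the endpoint is a null set.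
    · have : ∀ᵐ u : ℝ, u ≠ 1 := by simp [ae_iff]
      filter_upwards [this] with u hu1 hu
      rw [Set.uIoc_of_le (by norm_num)] at hu
      exact (norm_cexp_mul_I_sub_le _ _).trans
        (abs_inner_scaledVector_sub_le b hb w m ⟨hu.1.le, lt_of_le_of_ne hu.2 hu1⟩)
  simpa using hdiff.add h

theorem integral_comp_of_isUniform {Ω : Type*} [MeasurableSpace Ω] {P : Measure Ω} {U : Ω → ℝ}
    (hU : pdf.IsUniform U (Set.Icc (0 : ℝ) 1) P volume) {g : ℝ → ℂ} (hg : Measurable g) :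
    ∫ ω, g (U ω) ∂P = ∫ u in (0 : ℝ)..1, g u := by
  have hUm : AEMeasurable U P := pdf.IsUniform.aemeasurable (by simp) (by simp) hU
  rw [← integral_map hUm hg.aestronglyMeasurable, hU, ProbabilityTheory.cond,
    intervalIntegral.integral_of_le (by norm_num), integral_Icc_eq_integral_Ioc.symm]
  simp

theorem tendstoInDistribution_scaledVector {Ω : Type*} [MeasurableSpace Ω] (P : Measure Ω)
    [IsProbabilityMeasure P] (b : ℕ) [NeZero b] (hb : 2 ≤ b) (U : Ω → ℝ)
    (hU : pdf.IsUniform U (Set.Icc (0 : ℝ) 1) P volume) :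
    TendstoInDistribution (fun (m : ℕ) (ω : Ω) => scaledVector b m (U ω)) atTop
      (id : (Fin (b - 1) → ℂ) → (Fin (b - 1) → ℂ)) (fun _ => P) (stdComplexNormal (b - 1)) := by
  have hUm : AEMeasurable U P := pdf.IsUniform.aemeasurable (by simp) (by simp) hU
  -- Characteristic functions need an inner product, so the convergence is proved in
  -- `EuclideanSpace` and carried back by the continuous map `WithLp.ofLp`.
  have h : TendstoInDistribution
      (fun (m : ℕ) (ω : Ω) => WithLp.toLp 2 (scaledVector b m (U ω))) atTop
      (WithLp.toLp 2 : (Fin (b - 1) → ℂ) → EuclideanSpace ℂ (Fin (b - 1))) (fun _ => P)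
      (stdComplexNormal (b - 1)) := by
    have hm : ∀ m, AEMeasurable (fun ω => (WithLp.toLp 2 (scaledVector b m (U ω)) :
        EuclideanSpace ℂ (Fin (b - 1)))) P := fun m =>
      (by fun_prop : Measurable (WithLp.toLp 2)).comp_aemeasurable
        ((measurable_scaledVector b m).comp_aemeasurable hUm)
    refine ⟨hm, by fun_prop, ?_⟩
    refine ProbabilityMeasure.tendsto_of_tendsto_charFun fun w => ?_
    simp only [ProbabilityMeasure.coe_mk]
    rw [charFun_map_toLp_stdComplexNormal]
    refine (tendsto_integral_exp_inner_scaledVector b hb w).congr fun m => ?_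
    rw [charFun_apply, integral_map (hm m) (by fun_prop : Continuous _).aestronglyMeasurable]
    refine (integral_comp_of_isUniform hU ?_).symm
    have := measurable_scaledVector b m
    fun_prop
  exact h.continuous_comp (g := WithLp.ofLp) (by fun_prop)

end Lacunary

end

theorem theorem1 {Ω : Type*} [MeasurableSpace Ω] (P : Measure Ω) [IsProbabilityMeasure P]
    (b : ℕ) [NeZero b] (hb : 2 ≤ b) (U : Ω → ℝ)
    (hU : pdf.IsUniform U (Set.Icc (0 : ℝ) 1) P volume) :
    TendstoInDistribution (fun (m : ℕ) (ω : Ω) => Lacunary.scaledVector b m (U ω)) atTop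
        (id : (Fin (b - 1) → ℂ) → (Fin (b - 1) → ℂ))
        (fun _ => P) (Lacunary.stdComplexNormal (b - 1)) ∧
      TendstoInDistribution (fun (m : ℕ) (ω : Ω) => Lacunary.testStatistic b m (U ω)) atTop
        (id : ℝ → ℝ)
        (fun _ => P) (Lacunary.chiSquare (2 * (b - 1))) := by
  have h := Lacunary.tendstoInDistribution_scaledVector P b hb U hU
  refine ⟨h, ?_⟩
  -- The statistic is exactly this continuous function of the vector, since `|√m z|² = m |z|²`.
  have h2 := h.continuous_comp (g := fun z => 2 * ∑ i, ‖z i‖ ^ 2) (by fun_prop)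
  have e : ∀ (m : ℕ) (u : ℝ), 2 * ∑ i, ‖Lacunary.scaledVector b m u i‖ ^ 2
      = Lacunary.testStatistic b m u := by
    intro m u
    rw [Lacunary.testStatistic, Lacunary.sum_Icc_one_eq_sum_range, Finset.sum_range, mul_assoc,
      Finset.mul_sum (a := (m : ℝ))]
    congr 1
    refine Finset.sum_congr rfl fun i _ => ?_
    rw [Lacunary.scaledVector, norm_mul, mul_pow, Complex.norm_real, Real.norm_eq_abs, sq_abs,
      Real.sq_sqrt (by positivity)]
  have e' : (fun m : ℕ => (fun z : Fin (b - 1) → ℂ => 2 * ∑ i, ‖z i‖ ^ 2) ∘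
      fun ω => Lacunary.scaledVector b m (U ω))
      = fun (m : ℕ) (ω : Ω) => Lacunary.testStatistic b m (U ω) := by
    ext m ω
    exact e m (U ω)
  rw [e'] at h2
  refine ⟨h2.forall_aemeasurable, by fun_prop, ?_⟩
  convert h2.tendsto using 3
  refine congrArg 𝓝 (Subtype.ext ?_)
  change Measure.map id _ = Measure.map (fun z : Fin (b - 1) → ℂ => 2 * ∑ i, ‖z i‖ ^ 2) _
  rw [Lacunary.map_two_mul_sum_normSq_stdComplexNormal, Measure.map_id]
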